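/- Let $\Sigma$ be a finite alphabet. For $w\in\Sigma^*$ let $\mathrm{Facs}(w)$ be its set of factors, and let $\mathfrak A_w$ be the structure with universe $\mathrm{Facs}(w)\cup\{\perp\}$, the ternary relation $\{(a,b,c)\in\mathrm{Facs}(w)^3 : a=b\cdot c\}$, a constant $\varepsilon$ interpreted as the empty word, and for each $\mathtt a\in\Sigma$ a constant interpreted as $\mathtt a$ if $\mathtt a$ occurs in $w$ and as $\perp$ otherwise. $\mathsf{FC}$ is the set of first-order formulas with atoms $x\doteq y\cdot z$, where $x,y,z$ are variables or constants (true iff the values of $(x,y,z)$ lie in the relation), closed under $\land,\lor,\neg,\exists,\forall$; variables take values in, and quantifiers range over, $\mathrm{Facs}(w)$. $\mathsf{FC}[\mathsf{REG}]$ additionally has atoms $x\mathrel{\dot\in}\gamma$ (regular constraints) for a variable $x$ and a regular expression $\gamma$, true iff the value of $x$ belongs to $\mathcal L(\gamma)$. A sentence $\varphi$ defines the language $\mathcal L(\varphi)=\{w\in\Sigma^* : \mathfrak A_w\models\varphi\}$, and $\mathcal L(\mathsf{FC})$ and $\mathcal L(\mathsf{FC}[\mathsf{REG}])$ are the classes of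 languages defined by sentences of the respective logics. A language is bounded if it is a subset of $w_1^*w_2^*\cdots w_n^*$ for some $n\in\mathbb N$ and $w_1,\dots,w_n\in\Sigma^*$. **Lemma.** 1. If $L\subseteq\Sigma^*$ is a (finite) Boolean combination of bounded languages, then $L\in\mathcal L(\mathsf{FC})$ if and only if $L\in\mathcal L(\mathsf{FC}[\mathsf{REG}])$. 2. For every bounded language $B\subseteq\Sigma^*$ there are a bounded regular language $R$ and, for every variable $x$ and regular expression $\gamma$, an $\mathsf{FC}$-formula $\varphi_{x,\gamma}$ whose only free variable is $x$, such that: (a) for every $w\in\Sigma^*$ and every assignment $\sigma$ of factors of $w$ to the variables, $(\mathfrak A_w,\sigma)\models\varphi_{x,\gamma}$ if and only if $\sigma(x)\in\mathcal L(\gamma)\cap R$; and (b) replacing every regular constraint $x\mathrel{\dot\in}\gamma$ in an $\mathsf{FC}[\mathsf{REG}]$-formula $\varphi$ by $\varphi_{x,\gamma}$ yields an $\mathsf{FC}$-formula that is equivalent to $\varphi$ on every $\mathfrak A_w$ with $w\in B$ and every assignment $\sigma$. -/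

import Mathlib

open scoped Computability

namespace FCLogic

/-- The factors of `w`. The universe of the structure representing `w` is `Option (Facs w)`:
the factors of `w` together with a null value `⊥` (here `none`). -/
abbrev Facs {A : Type*} (w : List A) : Type _ := {u : List A // u <:+: w}

/-- The empty word as a factor of `w`. -/
def Facs.eps {A : Type*} (w : List A) : Facs w := ⟨[], List.nil_infix⟩

/-- Interpretation of the constant symbol of the letter `a` in the structure representing `w`:
the word `a` if `a` occurs in `w`, and `⊥` otherwise. -/
noncomputable def letterConst {A : Type*} (w : List A) (a : A) : Option (Facs w) :=
  open Classical in
  if h : a ∈ w then some ⟨[a], (List.singleton_infix_iff a w).2 h⟩ else none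

/-- The ternary concatenation relation of the structure representing `w`:
`a = b · c`, where `a`, `b`, `c` are factors of `w` (so none of them is `⊥`). -/
def ConcatRel {A : Type*} (w : List A) (a b c : Option (Facs w)) : Prop :=
  ∃ x y z : Facs w, a = some x ∧ b = some y ∧ c = some z ∧ x.1 = y.1 ++ z.1

/-- Variables (indexed by `ℕ`) and the constant symbols of the signature. -/
inductive Term (A : Type*) : Type _ where
  | var (x : ℕ)
  | letter (a : A)
  | eps

/-- Value of a term under an assignment of factors of `w` to the variables. -/
noncomputable def Term.val {A : Type*} {w : List A} (σ : ℕ → Facs w) : Term A → Option (Facs w)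
  | .var x => some (σ x)
  | .letter a => letterConst w a
  | .eps => some (Facs.eps w)

/-- Variables of a term. -/
def Term.vars {A : Type*} : Term A → Finset ℕ
  | .var x => {x}
  | .letter _ => ∅
  | .eps => ∅

/-- Formulas of `FC[REG]`. The atoms are `x ≐ y · z` (`concat x y z`) and the regular
constraints `x ∈ γ` (`constr x γ`). -/
inductive Formula (A : Type*) : Type _ where
  | concat (x y z : Term A)
  | constr (x : ℕ) (γ : RegularExpression A)
  | and (φ ψ : Formula A)
  | or (φ ψ : Formula A)
  | not (φ : Formula A)
  | all (x : ℕ) (φ : Formula A)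
  | ex (x : ℕ) (φ : Formula A)

namespace Formula

/-- `FC`-formulas: the `FC[REG]`-formulas without regular constraints. -/
def IsFC {A : Type*} : Formula A → Prop
  | concat _ _ _ => True
  | constr _ _ => False
  | and φ ψ => φ.IsFC ∧ ψ.IsFC
  | or φ ψ => φ.IsFC ∧ ψ.IsFC
  | not φ => φ.IsFC
  | all _ φ => φ.IsFC
  | ex _ φ => φ.IsFC

/-- Free variables. -/
def freeVars {A : Type*} : Formula A → Finset ℕ
  | concat x y z => x.vars ∪ y.vars ∪ z.vars
  | constr x _ => {x}
  | and φ ψ => φ.freeVars ∪ ψ.freeVars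
  | or φ ψ => φ.freeVars ∪ ψ.freeVars
  | not φ => φ.freeVars
  | all x φ => φ.freeVars.erase x
  | ex x φ => φ.freeVars.erase x

/-- Satisfaction in the structure representing `w` under the assignment `σ`.
Quantifiers range over the factors of `w`. -/
def Sat {A : Type*} (w : List A) (σ : ℕ → Facs w) : Formula A → Prop
  | concat x y z => ConcatRel w (x.val σ) (y.val σ) (z.val σ)
  | constr x γ => (σ x).1 ∈ γ.matches'
  | and φ ψ => Sat w σ φ ∧ Sat w σ ψ
  | or φ ψ => Sat w σ φ ∨ Sat w σ ψ
  | not φ => ¬ Sat w σ φ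
  | all x φ => ∀ u : Facs w, Sat w (Function.update σ x u) φ
  | ex x φ => ∃ u : Facs w, Sat w (Function.update σ x u) φ

/-- Replace every regular constraint `x ∈ γ` in a formula by the formula `f x γ`. -/
def replaceConstr {A : Type*} (f : ℕ → RegularExpression A → Formula A) : Formula A → Formula A
  | concat x y z => concat x y z
  | constr x γ => f x γ
  | and φ ψ => and (φ.replaceConstr f) (ψ.replaceConstr f)
  | or φ ψ => or (φ.replaceConstr f) (ψ.replaceConstr f)
  | not φ => not (φ.replaceConstr f)
  | all x φ => all x (φ.replaceConstr f)
  | ex x φ => ex x (φ.replaceConstr f)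

theorem _root_.FCLogic.Term.val_congr {A : Type*} {w : List A} {σ τ : ℕ → Facs w} (t : Term A)
    (h : ∀ x ∈ t.vars, σ x = τ x) : t.val σ = t.val τ := by
  cases t <;> simp_all [Term.val, Term.vars]

/-- Satisfaction depends only on the values of the free variables. -/
theorem sat_congr {A : Type*} {w : List A} (φ : Formula A) {σ τ : ℕ → Facs w}
    (h : ∀ x ∈ φ.freeVars, σ x = τ x) : Sat w σ φ ↔ Sat w τ φ := by
  induction φ generalizing σ τ with
  | concat x y z =>
    simp only [freeVars, Finset.mem_union] at h
    simp only [Sat]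
    rw [x.val_congr fun i hi => h i (.inl (.inl hi)), y.val_congr fun i hi => h i (.inl (.inr hi)),
      z.val_congr fun i hi => h i (.inr hi)]
  | constr x γ => simp only [Sat]; rw [h x (by simp [freeVars])]
  | and φ ψ h1 h2 | or φ ψ h1 h2 =>
    simp only [freeVars, Finset.mem_union] at h
    simp only [Sat]
    rw [h1 fun i hi => h i (.inl hi), h2 fun i hi => h i (.inr hi)]
  | not φ h1 => simp only [Sat]; rw [h1 h]
  | all x φ h1 =>
    refine forall_congr' fun u => h1 fun i hi => ?_
    by_cases hx : i = x
    · subst hx; simp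
    · simpa [hx] using h i (Finset.mem_erase.2 ⟨hx, hi⟩)
  | ex x φ h1 =>
    refine exists_congr fun u => h1 fun i hi => ?_
    by_cases hx : i = x
    · subst hx; simp
    · simpa [hx] using h i (Finset.mem_erase.2 ⟨hx, hi⟩)

/-- Sentences: formulas without free variables. -/
def IsSentence {A : Type*} (φ : Formula A) : Prop := φ.freeVars = ∅

/-- The language of a sentence (by `sat_congr` the assignment is irrelevant for sentences). -/
def language {A : Type*} (φ : Formula A) : Language A :=
  {w : List A | ∀ σ : ℕ → Facs w, Sat w σ φ}

end Formula

/-- The class of languages definable by an `FC`-sentence. -/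
def LangFC (A : Type*) : Set (Language A) :=
  {L | ∃ φ : Formula A, φ.IsFC ∧ φ.IsSentence ∧ φ.language = L}

/-- The class of languages definable by an `FC[REG]`-sentence. -/
def LangFCREG (A : Type*) : Set (Language A) :=
  {L | ∃ φ : Formula A, φ.IsSentence ∧ φ.language = L}

/-- `L` is bounded: `L ⊆ w₁* · w₂* ⋯ wₙ*` for some words `w₁, …, wₙ`. -/
def IsBounded {A : Type*} (L : Language A) : Prop :=
  ∃ ws : List (List A), L ≤ (ws.map fun w => ({w} : Language A)∗).prod

/-- `L` is a (finite) Boolean combination of bounded languages. -/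
def IsBoolCombBounded {A : Type*} (L : Language A) : Prop :=
  L ∈ BooleanSubalgebra.closure {K : Language A | IsBounded K}

end FCLogic

/-! If `B ⊆ w₁*⋯wₙ*`, every factor of a word of `B` lies in one larger product `R` of stars of
words. So on `B` a constraint `x ∈ γ` says no more than `x ∈ L(γ) ∩ R`, and it suffices to express
regular subsets of such products in `FC` (`Expressible.inf_starProd`).

Split the run of a DFA over the starred blocks. Within `w*`, the exponents leading from one state to
another are ultimately periodic, which leaves finite unions of words `wⁿ` and sets `wⁿ(wᴾ)*`
(`evalFrom_kstar`). To express `w*`, write `w = pᵏ` with `p` the primitive root: `x ∈ p*` iff `x =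
ε` or `x = py = yp` for some `y`, and `w*` consists of the `k`-th powers of elements of `p*`
(`kstar_singleton`). All auxiliary words are factors of `x`, so quantification over factors
suffices.

For Boolean combinations, one of `L` and `Lᶜ` is bounded, and both logics are closed under negation.
A bounded `L` is defined by the translated sentence together with a sentence for membership in
`w₁*⋯wₙ*`. -/

namespace FCLogic

/-! ### Closure of regular languages under the regular operations, via left quotients -/

section Regular

variable {A : Type*}

theorem isRegular_one : (1 : Language A).IsRegular := by
  refine .of_finite_range_leftQuotient ((Set.toFinite {1, 0}).subset ?_)
  rintro _ ⟨x, rfl⟩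
  rcases eq_or_ne x [] with rfl | hx
  · exact .inl rfl
  · refine .inr (Set.mem_singleton_iff.2 (Language.ext fun y => ?_))
    simp [Language.mem_leftQuotient, Language.mem_one, hx]

theorem isRegular_zero : (0 : Language A).IsRegular := by
  refine .of_finite_range_leftQuotient ((Set.toFinite {0}).subset ?_)
  rintro _ ⟨x, rfl⟩
  exact Set.mem_singleton_iff.2 (Language.ext fun y => Iff.rfl)

theorem isRegular_singleton_letter (a : A) : ({[a]} : Language A).IsRegular := by
  refine .of_finite_range_leftQuotient ((Set.toFinite {{[a]}, 1, 0}).subset ?_)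
  rintro _ ⟨x, rfl⟩
  rcases x with _ | ⟨b, x⟩
  · exact .inl rfl
  right
  by_cases h : b = a ∧ x = []
  · obtain ⟨rfl, rfl⟩ := h
    refine .inl (Language.ext fun y => ?_)
    rw [Language.mem_leftQuotient, Language.mem_one]
    exact Set.mem_singleton_iff.trans (by simp)
  · refine .inr (Set.mem_singleton_iff.2 (Language.ext fun y => ?_))
    rw [Language.mem_leftQuotient]
    refine (Set.mem_singleton_iff (a := _) (b := [a])).trans ?_
    simp only [List.cons_append, List.cons.injEq, List.append_eq_nil_iff, Language.notMem_zero,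
      iff_false]
    tauto

/-- The quotient of `L * M` by `x` is the quotient of `L` by `x`, times `M`, joined with the
quotients of `M` by those suffixes of `x` whose complementary prefix is in `L`. A quotient of `L`
and a set of quotients of `M` determine it, so there are finitely many. -/
theorem isRegular_mul {L M : Language A} (hL : L.IsRegular) (hM : M.IsRegular) :
    (L * M).IsRegular := by
  have hL := hL.finite_range_leftQuotient
  have hM := hM.finite_range_leftQuotient
  refine .of_finite_range_leftQuotient (((hL.prod hM.finite_subsets).image
    fun p : Language A × Set (Language A) => (p.1 * M ⊔ ({y | ∃ K ∈ p.2, y ∈ K} : Language A) : Language A)).subset ?_)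
  rintro _ ⟨x, rfl⟩
  refine ⟨⟨L.leftQuotient x, {K | ∃ u ∈ L, ∃ v, u ++ v = x ∧ M.leftQuotient v = K}⟩,
    ⟨⟨x, rfl⟩, ?_⟩, Language.ext fun y => ?_⟩
  · rintro _ ⟨u, -, v, -, rfl⟩
    exact ⟨v, rfl⟩
  · rw [Language.mem_leftQuotient, Language.mem_mul]
    constructor
    · rintro (⟨a, ha, b, hb, rfl⟩ | ⟨_, ⟨u, hu, v, rfl, rfl⟩, hy⟩)
      · exact ⟨_, ha, b, hb, by simp⟩
      · exact ⟨u, hu, _, hy, by simp⟩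
    · rintro ⟨a, ha, b, hb, h⟩
      rcases List.append_eq_append_iff.1 h with ⟨c, rfl, rfl⟩ | ⟨c, rfl, rfl⟩
      · exact .inr ⟨_, ⟨a, ha, c, rfl, rfl⟩, hb⟩
      · exact .inl ⟨c, ha, b, hb, rfl⟩

/-- The cut between `x` and `y` falls in, or at the end of, some block `v ++ a`. For empty `x` there
need not be any block. -/
theorem append_mem_kstar_iff {L : Language A} {x y : List A} (hx : x ≠ []) :
    x ++ y ∈ L∗ ↔ ∃ u ∈ L∗, ∃ v, u ++ v = x ∧ ∃ a, v ++ a ∈ L ∧ ∃ b ∈ L∗, a ++ b = y := by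
  constructor
  · rintro ⟨l, hl, hmem⟩
    induction l generalizing x with
    | nil => simp [hx] at hl
    | cons z l ih =>
      rw [List.flatten_cons] at hl
      have hl' : ∀ y ∈ l, y ∈ L := fun y hy => hmem y (by simp [hy])
      rcases List.append_eq_append_iff.1 hl with ⟨c, hc, rfl⟩ | ⟨c, rfl, h⟩
      · subst hc
        exact ⟨[], Language.nil_mem_kstar _, x, rfl, c, hmem _ (by simp), _,
          Language.join_mem_kstar hl', rfl⟩
      · rcases eq_or_ne c [] with rfl | hc
        · refine ⟨[], Language.nil_mem_kstar _, z, by simp, [], hmem _ (by simp), _,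
            Language.join_mem_kstar hl', by simpa using h⟩
        · obtain ⟨u, hu, v, rfl, r⟩ := ih hc h.symm hl'
          refine ⟨z ++ u, ?_, v, by simp, r⟩
          rw [← Language.one_add_self_mul_kstar_eq_kstar]
          exact .inr (Language.append_mem_mul (hmem _ (by simp)) hu)
  · rintro ⟨u, hu, v, rfl, a, ha, b, hb, rfl⟩
    have : (u ++ v) ++ (a ++ b) = u ++ ((v ++ a) ++ b) := by simp
    rw [this, ← kstar_mul_kstar]
    refine Language.append_mem_mul hu ?_
    rw [← Language.one_add_self_mul_kstar_eq_kstar]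
    exact .inr (Language.append_mem_mul ha hb)

theorem isRegular_kstar {L : Language A} (hL : L.IsRegular) : (L∗).IsRegular := by
  have hL := hL.finite_range_leftQuotient
  -- For nonempty `x` the quotient is a union of `K * L∗` over a set of quotients `K` of `L`; the
  -- inserted `L∗` covers `x = []`.
  refine .of_finite_range_leftQuotient (((hL.finite_subsets.image
    fun p : Set (Language A) => ({y | ∃ K ∈ p, y ∈ K * L∗} : Language A)).insert (L∗)).subset ?_)
  rintro _ ⟨x, rfl⟩
  rcases eq_or_ne x [] with rfl | hx
  · exact .inl rfl
  refine .inr ⟨{K | ∃ u ∈ L∗, ∃ v, u ++ v = x ∧ L.leftQuotient v = K}, ?_,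
    Language.ext fun y => ?_⟩
  · rintro _ ⟨u, -, v, -, rfl⟩
    exact ⟨v, rfl⟩
  · rw [Language.mem_leftQuotient, append_mem_kstar_iff hx]
    constructor
    · rintro ⟨_, ⟨u, hu, v, h, rfl⟩, hy⟩
      obtain ⟨a, ha, b, hb, rfl⟩ := Language.mem_mul.1 hy
      exact ⟨u, hu, v, h, a, ha, b, hb, rfl⟩
    · rintro ⟨u, hu, v, h, a, ha, b, hb, rfl⟩
      exact ⟨_, ⟨u, hu, v, h, rfl⟩, Language.append_mem_mul ha hb⟩

theorem isRegular_matches (γ : RegularExpression A) : γ.matches'.IsRegular := by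
  induction γ with
  | zero => exact isRegular_zero
  | epsilon => exact isRegular_one
  | char a => exact isRegular_singleton_letter a
  | plus P Q hP hQ => exact hP.add hQ
  | comp P Q hP hQ => exact isRegular_mul hP hQ
  | star P hP => exact isRegular_kstar hP

theorem singleton_cons (a : A) (w : List A) :
    ({a :: w} : Language A) = {[a]} * {w} := by
  refine Language.ext fun x => ?_
  rw [Language.mem_mul]
  constructor
  · rintro rfl
    exact ⟨[a], rfl, w, rfl, rfl⟩
  · rintro ⟨_, rfl, _, rfl, rfl⟩
    rfl

theorem isRegular_singleton (w : List A) : ({w} : Language A).IsRegular := by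
  induction w with
  | nil => exact isRegular_one
  | cons a w ih => rw [singleton_cons]; exact isRegular_mul (isRegular_singleton_letter a) ih

/-! ### Products of stars of words, their factors, and bounded languages -/

/-- The language `w₁* ⋯ wₙ*`. -/
def starProd (ws : List (List A)) : Language A :=
  (ws.map fun w => ({w} : Language A)∗).prod

@[simp] theorem starProd_cons (w : List A) (ws : List (List A)) :
    starProd (w :: ws) = {w}∗ * starProd ws := by
  simp [starProd]

@[simp] theorem starProd_append (ws vs : List (List A)) :
    starProd (ws ++ vs) = starProd ws * starProd vs := by
  simp [starProd]

theorem isBounded_starProd (ws : List (List A)) : IsBounded (starProd ws) := ⟨ws, le_rfl⟩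

theorem isRegular_starProd (ws : List (List A)) : (starProd ws).IsRegular := by
  induction ws with
  | nil => exact isRegular_one
  | cons w ws ih =>
    rw [starProd_cons]
    exact isRegular_mul (isRegular_kstar (isRegular_singleton w)) ih

theorem nil_mem_starProd (ws : List (List A)) : [] ∈ starProd ws := by
  induction ws with
  | nil => exact Language.nil_mem_one
  | cons w ws ih =>
    rw [starProd_cons]
    exact Language.append_mem_mul (Language.nil_mem_kstar _) ih

theorem mem_starProd_of_mem {ws : List (List A)} {w : List A} (h : w ∈ ws) : w ∈ starProd ws := by
  induction ws with
  | nil => simp at h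
  | cons v ws ih =>
    rw [starProd_cons]
    rcases List.mem_cons.1 h with rfl | h
    · have : [w].flatten ∈ ({w} : Language A)∗ :=
        Language.join_mem_kstar fun y hy => List.mem_singleton.1 hy
      simpa using Language.append_mem_mul this (nil_mem_starProd ws)
    · exact Language.append_mem_mul (Language.nil_mem_kstar _) (ih h)

/-- A finite list of words whose `starProd` contains the factors of `w*`. -/
def starFactors (w : List A) : List (List A) := w.sublists ++ w :: w.sublists

theorem append_mem_starFactors {w a b c : List A} (ha : a.Sublist w) (hb : b ∈ ({w} : Language A)∗)
    (hc : c.Sublist w) : a ++ (b ++ c) ∈ starProd (starFactors w) := by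
  rw [starFactors, starProd_append, starProd_cons]
  exact Language.append_mem_mul (mem_starProd_of_mem (List.mem_sublists.2 ha))
    (Language.append_mem_mul hb (mem_starProd_of_mem (List.mem_sublists.2 hc)))

theorem exists_of_prefix_mem_kstar {w x u : List A} (hx : x ∈ ({w} : Language A)∗) (hu : u <+: x) :
    ∃ b ∈ ({w} : Language A)∗, ∃ c, c.Sublist w ∧ u = b ++ c := by
  obtain ⟨l, rfl, hl⟩ := hx
  induction l generalizing u with
  | nil =>
    exact ⟨[], Language.nil_mem_kstar _, [], List.nil_sublist _, by simpa using hu⟩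
  | cons y l ih =>
    obtain rfl : y = w := hl y (by simp)
    rw [List.flatten_cons] at hu
    obtain ⟨v, hv⟩ := hu
    rcases List.append_eq_append_iff.1 hv with ⟨t, rfl, -⟩ | ⟨t, rfl, ht⟩
    · exact ⟨[], Language.nil_mem_kstar _, u, (List.prefix_append u t).sublist, rfl⟩
    · obtain ⟨b, hb, c, hc, rfl⟩ := ih (fun z hz => hl z (by simp [hz])) ⟨v, ht.symm⟩
      refine ⟨y ++ b, ?_, c, hc, by simp⟩
      rw [← Language.one_add_self_mul_kstar_eq_kstar]
      exact .inr (Language.append_mem_mul rfl hb)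

/-- A factor of a power of `w` lies inside one copy of `w`, or is a suffix of `w`, a power of `w`
and a prefix of `w` in succession. Sublists serve only as a finite supply containing all these
pieces. -/
theorem infix_mem_starFactors {w x u : List A} (hx : x ∈ ({w} : Language A)∗) (hu : u <:+: x) :
    u ∈ starProd (starFactors w) := by
  obtain ⟨l, rfl, hl⟩ := hx
  induction l generalizing u with
  | nil =>
    obtain rfl : u = [] := by simpa using hu
    exact nil_mem_starProd _
  | cons y l ih =>
    obtain rfl : y = w := hl y (by simp)
    have hl' : ∀ z ∈ l, z ∈ ({y} : Language A) := fun z hz => hl z (by simp [hz])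
    rw [List.flatten_cons] at hu
    rcases List.infix_append_iff.1 hu with h | h | ⟨s, t, rfl, hs, ht⟩
    · simpa using append_mem_starFactors h.sublist (Language.nil_mem_kstar _) (List.nil_sublist _)
    · exact ih hl' h
    · obtain ⟨b, hb, c, hc, rfl⟩ := exists_of_prefix_mem_kstar (Language.join_mem_kstar hl') ht
      exact append_mem_starFactors hs.sublist hb hc

theorem infix_mem_starProd {ws : List (List A)} {x u : List A} (hx : x ∈ starProd ws)
    (hu : u <:+: x) : u ∈ starProd (ws.flatMap starFactors) := by
  induction ws generalizing x u with
  | nil =>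
    obtain rfl : x = [] := hx
    obtain rfl : u = [] := by simpa using hu
    exact nil_mem_starProd _
  | cons w ws ih =>
    rw [starProd_cons] at hx
    obtain ⟨a, ha, b, hb, rfl⟩ := Language.mem_mul.1 hx
    rw [List.flatMap_cons, starProd_append]
    rcases List.infix_append_iff.1 hu with h | h | ⟨s, t, rfl, hs, ht⟩
    · simpa using Language.append_mem_mul (infix_mem_starFactors ha h) (nil_mem_starProd _)
    · exact Language.append_mem_mul (nil_mem_starProd (starFactors w)) (ih hb h)
    · exact Language.append_mem_mul (infix_mem_starFactors ha hs.isInfix) (ih hb ht.isInfix)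

theorem IsBounded.sup {L M : Language A} (hL : IsBounded L) (hM : IsBounded M) :
    IsBounded (L ⊔ M) := by
  obtain ⟨ws, hL⟩ := hL
  obtain ⟨vs, hM⟩ := hM
  refine ⟨ws ++ vs, sup_le (fun x hx => ?_) fun x hx => ?_⟩ <;> change x ∈ starProd (ws ++ vs) <;>
    rw [starProd_append]
  · rw [← List.append_nil x]
    exact Language.append_mem_mul (hL hx) (nil_mem_starProd vs)
  · exact Language.append_mem_mul (nil_mem_starProd ws) (hM hx)

theorem IsBounded.mono {L M : Language A} (hM : IsBounded M) (h : L ≤ M) : IsBounded L :=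
  hM.imp fun _ h' => h.trans h'

/-- The bounded and co-bounded languages form a Boolean algebra: if either language is co-bounded,
the complement of the union sits inside a bounded complement. -/
theorem IsBoolCombBounded.isBounded_or_compl {L : Language A} (h : IsBoolCombBounded L) :
    IsBounded L ∨ IsBounded Lᶜ := by
  refine BooleanSubalgebra.closure_bot_sup_induction (p := fun L _ => IsBounded L ∨ IsBounded Lᶜ)
    (fun _ hx => .inl hx) (.inl ((isBounded_starProd []).mono bot_le)) ?_ ?_ h
  · rintro x - y - (hx | hx) (hy | hy)
    · exact .inl (hx.sup hy)
    all_goals right; rw [compl_sup]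
    · exact hy.mono inf_le_right
    · exact hx.mono inf_le_left
    · exact hx.mono inf_le_left
  · rintro x - (hx | hx)
    · exact .inr (by rwa [compl_compl])
    · exact .inl hx

end Regular

/-! ### Powers of words, primitive roots, iterated transitions -/

section Words

variable {A : Type*}

/-- The word `wⁿ`. -/
def wordPow (w : List A) (n : ℕ) : List A := (List.replicate n w).flatten

@[simp] theorem wordPow_zero (w : List A) : wordPow w 0 = [] := rfl

theorem wordPow_succ (w : List A) (n : ℕ) : wordPow w (n + 1) = w ++ wordPow w n := by
  simp [wordPow, List.replicate_succ]

theorem wordPow_add (w : List A) (m n : ℕ) : wordPow w (m + n) = wordPow w m ++ wordPow w n := by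
  induction m with
  | zero => simp
  | succ m ih => rw [Nat.succ_add, wordPow_succ, wordPow_succ, ih, List.append_assoc]

theorem wordPow_one (w : List A) : wordPow w 1 = w := by simp [wordPow]

theorem wordPow_succ' (w : List A) (n : ℕ) : wordPow w (n + 1) = wordPow w n ++ w := by
  rw [wordPow_add, wordPow_one]

theorem wordPow_mul (w : List A) (m n : ℕ) : wordPow w (m * n) = wordPow (wordPow w m) n := by
  induction n with
  | zero => simp
  | succ n ih => rw [Nat.mul_succ, wordPow_add, wordPow_succ', ih]

@[simp] theorem length_wordPow (w : List A) (n : ℕ) : (wordPow w n).length = n * w.length := by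
  simp [wordPow]

theorem mem_kstar_singleton {w x : List A} :
    x ∈ ({w} : Language A)∗ ↔ ∃ n, x = wordPow w n := by
  constructor
  · rintro ⟨l, rfl, hl⟩
    exact ⟨l.length, congrArg _ (List.eq_replicate_of_mem hl)⟩
  · rintro ⟨n, rfl⟩
    exact Language.join_mem_kstar fun y hy => List.eq_of_mem_replicate hy

theorem append_wordPow_comm {x w : List A} (h : x ++ w = w ++ x) (n : ℕ) :
    x ++ wordPow w n = wordPow w n ++ x := by
  induction n with
  | zero => simp
  | succ n ih => rw [wordPow_succ, ← List.append_assoc, h, List.append_assoc, ih, List.append_assoc]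

/-- A word commuting with `w` commutes with its powers, hence is a prefix of every sufficiently long
power; two prefixes of one word are comparable. -/
theorem prefix_of_append_comm {w p x : List A} (hw : w ≠ []) (hp : p ++ w = w ++ p)
    (hx : x ++ w = w ++ x) (hlen : p.length ≤ x.length) : p <+: x := by
  have h : x.length ≤ (wordPow w x.length).length := by
    rw [length_wordPow]
    exact Nat.le_mul_of_pos_right _ (List.length_pos_of_ne_nil hw)
  refine List.prefix_of_prefix_length_le ?_
    (List.prefix_of_prefix_length_le ⟨_, append_wordPow_comm hx x.length⟩
      (List.prefix_append _ x) h) hlen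
  exact List.prefix_of_prefix_length_le ⟨_, append_wordPow_comm hp x.length⟩
      (List.prefix_append _ p) (hlen.trans h)

/-- The words that commute with a nonempty word `w` are the powers of the primitive root `p`
of `w`. -/
theorem exists_root {w : List A} (hw : w ≠ []) :
    ∃ p : List A, p ≠ [] ∧ ∀ x : List A, x ++ w = w ++ x → ∃ n, x = wordPow p n := by
  classical
  -- The root is a shortest nonempty word commuting with `w`. It can be stripped from any other such
  -- word, and the remainder still commutes with `w`.
  have hex : ∃ n, ∃ p : List A, p.length = n ∧ p ≠ [] ∧ p ++ w = w ++ p := ⟨_, w, rfl, hw, rfl⟩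
  obtain ⟨p, hpl, hp0, hpw⟩ := Nat.find_spec hex
  refine ⟨p, hp0, fun x hx => ?_⟩
  induction hn : x.length using Nat.strong_induction_on generalizing x with
  | _ n ih =>
    rcases eq_or_ne x [] with rfl | hx0
    · exact ⟨0, rfl⟩
    have hle : p.length ≤ x.length := hpl ▸ Nat.find_min' hex ⟨x, rfl, hx0, hx⟩
    obtain ⟨y, rfl⟩ := prefix_of_append_comm hw hpw hx hle
    have hy : y ++ w = w ++ y := by
      apply List.append_cancel_left (as := p)
      rw [← List.append_assoc, hx, ← List.append_assoc, ← List.append_assoc, hpw]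
    have : 0 < p.length := List.length_pos_of_ne_nil hp0
    obtain ⟨m, rfl⟩ := ih y.length (by simp at hn; omega) y hy rfl
    exact ⟨m + 1, (wordPow_succ _ _).symm⟩

theorem iterate_add_mul_period {Q : Type*} {f : Q → Q} {i P : ℕ} (h : f^[i + P] = f^[i]) {m : ℕ}
    (hm : i ≤ m) (t : ℕ) : f^[m + P * t] = f^[m] := by
  have key : f^[m + P] = f^[m] := by
    obtain ⟨k, rfl⟩ := Nat.exists_eq_add_of_le hm
    rw [show i + k + P = k + (i + P) by ring, Function.iterate_add, h, ← Function.iterate_add,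
      add_comm k]
  induction t with
  | zero => rfl
  | succ t ih =>
    rw [show m + P * (t + 1) = P * t + (m + P) by ring, Function.iterate_add, key,
      ← Function.iterate_add, add_comm, ih]

theorem evalFrom_wordPow {Q : Type*} (M : DFA A Q) (w : List A) (q : Q) (n : ℕ) :
    M.evalFrom q (wordPow w n) = (fun s => M.evalFrom s w)^[n] q := by
  induction n generalizing q with
  | zero => rfl
  | succ n ih => rw [wordPow_succ, DFA.evalFrom_of_append, ih, Function.iterate_succ_apply]

end Words

/-! ### Languages expressible in `FC` as properties of a factor -/

section Expressible

variable {A : Type*}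

theorem concatRel_some {w : List A} {a b c : Facs w} :
    ConcatRel w (some a) (some b) (some c) ↔ a.1 = b.1 ++ c.1 := by
  constructor
  · rintro ⟨x, y, z, hx, hy, hz, h⟩
    cases hx; cases hy; cases hz
    exact h
  · exact fun h => ⟨a, b, c, rfl, rfl, rfl, h⟩

/-- The factor of `w` given by a factor of a factor of `w`. -/
def Facs.sub {w : List A} (u : Facs w) (v : List A) (h : v <:+: u.1) : Facs w := ⟨v, h.trans u.2⟩

/-- The language `L` is expressed, as a property of factors, by `FC`-formulas. -/
def Expressible (L : Language A) : Prop :=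
  ∀ x : ℕ, ∃ φ : Formula A, φ.IsFC ∧ φ.freeVars ⊆ {x} ∧
    ∀ (w : List A) (σ : ℕ → Facs w), φ.Sat w σ ↔ (σ x).1 ∈ L

namespace Expressible

theorem one : Expressible (1 : Language A) := fun x =>
  ⟨.concat (.var x) .eps .eps, trivial, by simp [Formula.freeVars, Term.vars], fun w σ => by
    simp [Formula.Sat, Term.val, concatRel_some, Facs.eps, Language.mem_one]⟩

theorem letter (a : A) : Expressible ({[a]} : Language A) := fun x =>
  ⟨.concat (.var x) (.letter a) .eps, trivial, by simp [Formula.freeVars, Term.vars], fun w σ => by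
    simp only [Formula.Sat, Term.val, letterConst]
    change _ ↔ (σ x).1 = [a]
    split_ifs with h
    · simp [concatRel_some, Facs.eps]
    -- If `a` does not occur, its constant is `⊥` and the atom fails; correctly so, since no factor
    -- equals `[a]`.
    · refine ⟨fun ⟨_, _, _, _, h, _⟩ => (by simp at h), fun h' => (h ?_).elim⟩
      exact (List.singleton_infix_iff a w).1 (h' ▸ (σ x).2)⟩

theorem congr {L M : Language A} (h : Expressible M) (e : ∀ x, x ∈ L ↔ x ∈ M) : Expressible L :=
  Language.ext e ▸ h

theorem sup {L M : Language A} (hL : Expressible L) (hM : Expressible M) :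
    Expressible (L ⊔ M) := fun x => by
  obtain ⟨φ, h1, h2, h3⟩ := hL x
  obtain ⟨ψ, k1, k2, k3⟩ := hM x
  exact ⟨.or φ ψ, ⟨h1, k1⟩, Finset.union_subset h2 k2, fun w σ => or_congr (h3 w σ) (k3 w σ)⟩

theorem bot : Expressible (⊥ : Language A) := fun x => by
  obtain ⟨φ, h1, h2, h3⟩ := one (A := A) x
  exact ⟨.and φ (.not φ), ⟨h1, h1⟩, Finset.union_subset h2 h2, fun w σ => by
    simp only [Formula.Sat, and_not_self_iff, false_iff]
    exact id⟩

theorem iSup {ι : Type*} [Finite ι] {L : ι → Language A} (h : ∀ i, Expressible (L i)) :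
    Expressible (⨆ i, L i) := by
  classical
  have := Fintype.ofFinite ι
  rw [← Finset.sup_univ_eq_iSup]
  induction (Finset.univ : Finset ι) using Finset.induction_on with
  | empty => exact bot
  | insert i s _ ih => rw [Finset.sup_insert]; exact (h i).sup ih

theorem mul {L M : Language A} (hL : Expressible L) (hM : Expressible M) :
    Expressible (L * M) := fun x => by
  obtain ⟨φ, h1, h2, h3⟩ := hL (x + 1)
  obtain ⟨ψ, k1, k2, k3⟩ := hM (x + 2)
  refine ⟨.ex (x + 1) (.ex (x + 2) (.and (.concat (.var x) (.var (x + 1)) (.var (x + 2)))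
    (.and φ ψ))), ⟨trivial, h1, k1⟩, fun y => ?_, fun w σ => ?_⟩
  · have h2 := @h2 y
    have k2 := @k2 y
    simp only [Formula.freeVars, Term.vars, Finset.mem_erase, Finset.mem_union,
      Finset.mem_singleton] at *
    tauto
  · simp only [Formula.Sat, h3, k3, Term.val, concatRel_some]
    simp only [Function.update_self, ne_eq, Nat.add_left_cancel_iff, Nat.reduceEqDiff,
      not_false_eq_true, Function.update_of_ne, Nat.left_eq_add, one_ne_zero, OfNat.ofNat_ne_zero]
    constructor
    · rintro ⟨u, v, h, hu, hv⟩
      rw [h]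
      exact Language.append_mem_mul hu hv
    · intro h
      obtain ⟨u, hu, v, hv, h⟩ := Language.mem_mul.1 h
      exact ⟨(σ x).sub u (h ▸ List.infix_append_left), (σ x).sub v (h ▸ List.infix_append_right),
        h.symm, hu, hv⟩

theorem singleton (w : List A) : Expressible ({w} : Language A) := by
  induction w with
  | nil => exact one
  | cons a w ih => rw [singleton_cons]; exact (letter a).mul ih

theorem exists_wordPow_formula (k x z : ℕ) (hxz : x ≠ z) : ∃ φ : Formula A, φ.IsFC ∧
    φ.freeVars ⊆ {x, z} ∧
      ∀ (w : List A) (σ : ℕ → Facs w), φ.Sat w σ ↔ (σ x).1 = wordPow (σ z).1 k := by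
  induction k generalizing x with
  | zero =>
    obtain ⟨φ, h1, h2, h3⟩ := one (A := A) x
    exact ⟨φ, h1, h2.trans (by simp), h3⟩
  | succ k ih =>
    -- The index `x + z + 1` is fresh for both `x` and `z`; it holds the power with one copy
    -- removed.
    obtain ⟨φ, h1, h2, h3⟩ := ih (x + z + 1) (by omega)
    refine ⟨.ex (x + z + 1) (.and (.concat (.var x) (.var z) (.var (x + z + 1))) φ),
      ⟨trivial, h1⟩, fun y => ?_, fun w σ => ?_⟩
    · have h2 := @h2 y
      simp only [Formula.freeVars, Term.vars, Finset.mem_erase, Finset.mem_union,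
        Finset.mem_insert, Finset.mem_singleton] at *
      tauto
    · have e1 : x ≠ x + z + 1 := by omega
      have e2 : z ≠ x + z + 1 := by omega
      simp only [Formula.Sat, h3, Term.val, concatRel_some, Function.update_self,
        Function.update_of_ne e1, Function.update_of_ne e2, wordPow_succ]
      constructor
      · rintro ⟨u, h, hu⟩
        rw [h, hu]
      · intro h
        exact ⟨(σ x).sub (wordPow (σ z).1 k) (h ▸ List.infix_append_right), h, rfl⟩

/-- With a positive exponent the base `z` is a factor of `x`, so the quantifier reaches it; with
exponent zero it might not. -/
theorem wordPow {L : Language A} (hL : Expressible L) (k : ℕ) :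
    Expressible ({x | ∃ z ∈ L, x = wordPow z (k + 1)} : Language A) := fun x => by
  obtain ⟨φ, h1, h2, h3⟩ := exists_wordPow_formula (A := A) (k + 1) x (x + 1) (by omega)
  obtain ⟨ψ, k1, k2, k3⟩ := hL (x + 1)
  refine ⟨.ex (x + 1) (.and φ ψ), ⟨h1, k1⟩, fun y => ?_, fun w σ => ?_⟩
  · have h2 := @h2 y
    have k2 := @k2 y
    simp only [Formula.freeVars, Finset.mem_erase, Finset.mem_union, Finset.mem_insert,
      Finset.mem_singleton] at *
    tauto
  · have e1 : x ≠ x + 1 := by omega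
    simp only [Formula.Sat, h3, k3, Function.update_self, Function.update_of_ne e1]
    constructor
    · rintro ⟨u, h, hu⟩
      exact ⟨u, hu, h⟩
    · rintro ⟨u, hu, h⟩
      exact ⟨(σ x).sub u (h ▸ wordPow_succ u k ▸ List.infix_append_left), h, hu⟩

theorem commute (p : List A) :
    Expressible ({x | ∃ y, x = p ++ y ∧ x = y ++ p} : Language A) := fun x => by
  obtain ⟨φ, h1, h2, h3⟩ := singleton p (x + 1)
  refine ⟨.ex (x + 1) (.and φ (.ex (x + 2) (.and
    (.concat (.var x) (.var (x + 1)) (.var (x + 2)))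
    (.concat (.var x) (.var (x + 2)) (.var (x + 1)))))), ⟨h1, trivial, trivial⟩,
    fun y => ?_, fun w σ => ?_⟩
  · have h2 := @h2 y
    simp only [Formula.freeVars, Term.vars, Finset.mem_erase, Finset.mem_union,
      Finset.mem_singleton] at *
    tauto
  · simp only [Formula.Sat, h3, Term.val, concatRel_some]
    simp only [Function.update_self, ne_eq, Nat.add_left_cancel_iff, Nat.reduceEqDiff,
      not_false_eq_true, Function.update_of_ne, Nat.left_eq_add, one_ne_zero, OfNat.ofNat_ne_zero]
    constructor
    · rintro ⟨u, hu, v, h⟩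
      obtain rfl : u.1 = p := hu
      exact ⟨v.1, h⟩
    · rintro ⟨y, h, h'⟩
      exact ⟨(σ x).sub p (h ▸ List.infix_append_left), rfl,
        (σ x).sub y (h ▸ List.infix_append_right), h, h'⟩

theorem kstar_singleton (w : List A) : Expressible ({w} : Language A)∗ := by
  rcases eq_or_ne w [] with rfl | hw
  · exact (_root_.kstar_one (α := Language A)).symm ▸ one
  obtain ⟨p, hp0, hp⟩ := exists_root hw
  obtain ⟨k, hk⟩ := hp w rfl
  have hpstar : Expressible ({p} : Language A)∗ := by
    refine (one.sup (commute p)).congr fun x => ?_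
    rw [mem_kstar_singleton]
    constructor
    · rintro ⟨_ | n, rfl⟩
      · exact .inl rfl
      · exact .inr ⟨_, wordPow_succ p n, wordPow_succ' p n⟩
    · rintro (hx | ⟨y, rfl, h⟩)
      · exact ⟨0, hx⟩
      -- Commuting with `p` implies commuting with `w = pᵏ`, so `y` is a power of the root.
      · obtain ⟨n, rfl⟩ := hp y (hk ▸ append_wordPow_comm h.symm k)
        exact ⟨n + 1, (wordPow_succ _ _).symm⟩
  obtain _ | k := k
  · exact (hw hk).elim
  refine (hpstar.wordPow k).congr fun x => ?_
  rw [mem_kstar_singleton]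
  constructor
  · rintro ⟨n, rfl⟩
    exact ⟨_, mem_kstar_singleton.2 ⟨n, rfl⟩, by rw [← wordPow_mul, mul_comm, wordPow_mul, ← hk]⟩
  · rintro ⟨z, hz, rfl⟩
    obtain ⟨n, rfl⟩ := mem_kstar_singleton.1 hz
    exact ⟨n, by rw [← wordPow_mul, mul_comm, wordPow_mul, ← hk]⟩

theorem starProd (ws : List (List A)) : Expressible (starProd ws) := by
  induction ws with
  | nil => exact one
  | cons w ws ih => rw [starProd_cons]; exact (kstar_singleton w).mul ih

/-- Reading `w` is a self-map of a finite set, so its iterates are ultimately periodic. -/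
theorem evalFrom_kstar {Q : Type*} [Finite Q] (M : DFA A Q) (w : List A) (q r : Q) :
    Expressible ({x | x ∈ ({w} : Language A)∗ ∧ M.evalFrom q x = r} : Language A) := by
  obtain ⟨i, j, hij, hf⟩ : ∃ i j, i < j ∧
      (fun s => M.evalFrom s w)^[i] = (fun s => M.evalFrom s w)^[j] := by
    obtain ⟨i, j, hne, h⟩ := Finite.exists_ne_map_eq_of_infinite
      fun n : ℕ => (fun s => M.evalFrom s w)^[n]
    rcases lt_or_gt_of_ne hne with hlt | hlt
    · exact ⟨i, j, hlt, h⟩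
    · exact ⟨j, i, hlt, h.symm⟩
  obtain ⟨P, rfl⟩ := Nat.exists_eq_add_of_lt hij
  rw [add_assoc] at hf
  -- Preperiod `i`, period `P + 1`: a good exponent below `i` contributes one word, one from `i` on
  -- a whole progression.
  refine (iSup (ι := {n : Fin (i + (P + 1)) // (fun s => M.evalFrom s w)^[n.1] q = r})
    (L := fun n => if n.1.1 < i then {FCLogic.wordPow w n.1} else
      {FCLogic.wordPow w n.1} * {FCLogic.wordPow w (P + 1)}∗) fun n => ?_).congr fun x => ?_
  rotate_left
  · refine Iff.trans ?_ Language.mem_iSup.symm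
    constructor
    · rintro ⟨hx, hr⟩
      obtain ⟨n, rfl⟩ := mem_kstar_singleton.1 hx
      rw [evalFrom_wordPow] at hr
      rcases lt_or_ge n i with hn | hn
      · refine ⟨⟨⟨n, by omega⟩, hr⟩, ?_⟩
        rw [if_pos hn]
        rfl
      · have hm := Nat.mod_lt (n - i) (show 0 < P + 1 by omega)
        have e : n = i + (n - i) % (P + 1) + (P + 1) * ((n - i) / (P + 1)) := by
          have := Nat.mod_add_div (n - i) (P + 1)
          omega
        refine ⟨⟨⟨i + (n - i) % (P + 1), by omega⟩, ?_⟩, ?_⟩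
        · rw [← hr]
          conv_rhs => rw [e]
          rw [iterate_add_mul_period hf.symm (by omega)]
        · rw [if_neg (by simp)]
          have hw : FCLogic.wordPow w n = _ :=
            (congrArg _ e).trans ((wordPow_add ..).trans (congrArg _ (wordPow_mul ..)))
          rw [hw]
          exact Language.append_mem_mul rfl (mem_kstar_singleton.2 ⟨_, rfl⟩)
    · rintro ⟨⟨n, hn⟩, hx⟩
      split_ifs at hx with h
      · obtain rfl : x = _ := hx
        exact ⟨mem_kstar_singleton.2 ⟨_, rfl⟩, by rw [evalFrom_wordPow, hn]⟩
      · obtain ⟨_, rfl, b, hb, rfl⟩ := Language.mem_mul.1 hx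
        obtain ⟨t, rfl⟩ := mem_kstar_singleton.1 hb
        rw [← wordPow_mul, ← wordPow_add]
        refine ⟨mem_kstar_singleton.2 ⟨_, rfl⟩, ?_⟩
        rw [evalFrom_wordPow, iterate_add_mul_period hf.symm (not_lt.1 h), hn]
  · split_ifs
    · exact singleton _
    · exact (singleton _).mul (kstar_singleton _)

/-- Take the union over the state `s` reached after the first starred block. -/
theorem evalFrom_starProd {Q : Type*} [Finite Q] (M : DFA A Q) (ws : List (List A)) (q r : Q) :
    Expressible ({x | x ∈ FCLogic.starProd ws ∧ M.evalFrom q x = r} : Language A) := by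
  induction ws generalizing q with
  | nil =>
    by_cases h : q = r
    · refine one.congr fun x => ⟨And.left, fun hx => ⟨hx, ?_⟩⟩
      rw [(Language.mem_one x).1 hx, DFA.evalFrom_nil, h]
    · refine bot.congr fun x => ⟨fun hx => h ?_, False.elim⟩
      rw [← hx.2, (Language.mem_one x).1 hx.1, DFA.evalFrom_nil]
  | cons w ws ih =>
    refine (iSup fun s : Q => (evalFrom_kstar M w q s).mul (ih s)).congr fun x => ?_
    refine Iff.trans ?_ Language.mem_iSup.symm
    constructor
    · rintro ⟨hx, hr⟩
      rw [starProd_cons] at hx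
      obtain ⟨a, ha, b, hb, rfl⟩ := Language.mem_mul.1 hx
      exact ⟨M.evalFrom q a, Language.append_mem_mul ⟨ha, rfl⟩
        ⟨hb, by rw [← hr, DFA.evalFrom_of_append]⟩⟩
    · rintro ⟨s, hx⟩
      obtain ⟨a, ⟨ha, rfl⟩, b, ⟨hb, h⟩, rfl⟩ := Language.mem_mul.1 hx
      refine ⟨?_, by rw [DFA.evalFrom_of_append, h]⟩
      rw [starProd_cons]
      exact Language.append_mem_mul ha hb

/-- A regular subset of `w₁* ⋯ wₙ*` is expressible in `FC`. -/
theorem inf_starProd {L : Language A} (hL : L.IsRegular) (ws : List (List A)) :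
    Expressible (L ⊓ FCLogic.starProd ws) := by
  obtain ⟨Q, _, M, rfl⟩ := hL
  refine (iSup fun r : M.accept => evalFrom_starProd M ws M.start r.1).congr fun x => ?_
  refine Iff.trans ?_ Language.mem_iSup.symm
  exact ⟨fun ⟨h, h'⟩ => ⟨⟨_, h⟩, h', rfl⟩, fun ⟨r, h, h'⟩ =>
    ⟨show M.evalFrom M.start x ∈ M.accept from h'.symm ▸ r.2, h⟩⟩

/-- The formulas expressing a language can be chosen with exactly one free variable. -/
theorem exists_formula {L : Language A} (h : Expressible L) (x : ℕ) :
    ∃ φ : Formula A, φ.IsFC ∧ φ.freeVars = {x} ∧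
      ∀ (w : List A) (σ : ℕ → Facs w), φ.Sat w σ ↔ (σ x).1 ∈ L := by
  obtain ⟨φ, h1, h2, h3⟩ := h x
  -- The conjunct `x ≐ x · ε` always holds and makes `x` occur free.
  refine ⟨.and φ (.concat (.var x) (.var x) .eps), ⟨h1, trivial⟩, ?_, fun w σ => ?_⟩
  · simpa only [Formula.freeVars, Term.vars, Finset.union_idempotent, Finset.union_empty,
      Finset.union_eq_right] using h2
  · simp [Formula.Sat, h3, Term.val, concatRel_some, Facs.eps]

/-- An `FC`-sentence for an expressible language. -/
theorem exists_sentence {L : Language A} (h : Expressible L) :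
    ∃ φ : Formula A, φ.IsFC ∧ φ.IsSentence ∧
      ∀ (w : List A) (σ : ℕ → Facs w), φ.Sat w σ ↔ w ∈ L := by
  obtain ⟨φ, h1, h2, h3⟩ := h 0
  -- The whole word has no name in the signature; it is the only factor that contains every factor.
  refine ⟨.ex 0 (.and φ (.all 1 (.ex 2 (.ex 3 (.ex 4 (.and
    (.concat (.var 0) (.var 2) (.var 3)) (.concat (.var 3) (.var 1) (.var 4)))))))),
    ⟨h1, trivial, trivial⟩, Finset.eq_empty_of_forall_notMem fun y => ?_, fun w σ => ?_⟩
  · have h2 := @h2 y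
    simp only [Formula.freeVars, Term.vars, Finset.mem_erase, Finset.mem_union,
      Finset.mem_singleton] at *
    tauto
  · simp only [Formula.Sat, h3, Term.val, concatRel_some, Function.update_self, ne_eq,
      Function.update_of_ne, OfNat.zero_ne_ofNat, OfNat.one_ne_ofNat,
      zero_ne_one, Nat.reduceEqDiff, not_false_eq_true]
    constructor
    · rintro ⟨u, hu, h⟩
      obtain ⟨a, b, c, h, h'⟩ := h ⟨w, List.infix_rfl⟩
      rw [← u.2.sublist.antisymm (h ▸ h' ▸ ?_)]
      · exact hu
      · exact (List.infix_append' _ _ _).sublist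
    · intro h
      refine ⟨⟨w, List.infix_rfl⟩, h, ?_⟩
      rintro ⟨u, a, c, h⟩
      rw [List.append_assoc] at h
      refine ⟨⟨a, ?_⟩, ⟨u ++ c, ?_⟩, ⟨c, ?_⟩, h.symm, rfl⟩
      · exact h ▸ List.infix_append_left
      · exact h ▸ List.infix_append_right
      · exact h ▸ List.infix_append_of_infix_right List.infix_append_right

end Expressible

end Expressible

/-! ### Eliminating regular constraints and comparing the two logics -/

section Replace

variable {A : Type*}

namespace Formula

theorem replaceConstr_isFC {f : ℕ → RegularExpression A → Formula A} (hf : ∀ x γ, (f x γ).IsFC)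
    (φ : Formula A) : (φ.replaceConstr f).IsFC := by
  induction φ with
  | concat => trivial
  | constr x γ => exact hf x γ
  | and φ ψ h1 h2 | or φ ψ h1 h2 => exact ⟨h1, h2⟩
  | not φ h | all _ φ h | ex _ φ h => exact h

theorem freeVars_replaceConstr {f : ℕ → RegularExpression A → Formula A}
    (hf : ∀ x γ, (f x γ).freeVars = {x}) (φ : Formula A) :
    (φ.replaceConstr f).freeVars = φ.freeVars := by
  induction φ with
  | concat => rfl
  | constr x γ => exact hf x γ
  | and φ ψ h1 h2 | or φ ψ h1 h2 => simp only [replaceConstr, freeVars, h1, h2]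
  | not φ h | all _ φ h | ex _ φ h => simp only [replaceConstr, freeVars, h]

theorem sat_replaceConstr {f : ℕ → RegularExpression A → Formula A} {w : List A}
    (hf : ∀ x γ (σ : ℕ → Facs w), (f x γ).Sat w σ ↔ (σ x).1 ∈ γ.matches') (φ : Formula A)
    (σ : ℕ → Facs w) : (φ.replaceConstr f).Sat w σ ↔ φ.Sat w σ := by
  induction φ generalizing σ with
  | concat => rfl
  | constr x γ => exact hf x γ σ
  | and φ ψ h1 h2 | or φ ψ h1 h2 => simp only [replaceConstr, Sat, h1, h2]
  | not φ h | all _ φ h | ex _ φ h => simp only [replaceConstr, Sat, h]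

theorem IsSentence.mem_language_iff {φ : Formula A} (h : φ.IsSentence) {w : List A}
    (σ : ℕ → Facs w) : w ∈ φ.language ↔ φ.Sat w σ :=
  ⟨fun hw => hw σ, fun hw _ => (sat_congr φ (by simp [show φ.freeVars = ∅ from h])).2 hw⟩

theorem IsSentence.language_not {φ : Formula A} (h : φ.IsSentence) :
    (Formula.not φ).language = φ.languageᶜ := by
  refine Language.ext fun w => ?_
  have hn : (Formula.not φ).IsSentence := h
  rw [hn.mem_language_iff fun _ => Facs.eps w]
  exact not_congr (h.mem_language_iff _).symm

end Formula

theorem LangFC.compl_mem {L : Language A} (h : L ∈ LangFC A) : Lᶜ ∈ LangFC A := by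
  obtain ⟨φ, h1, h2, rfl⟩ := h
  exact ⟨.not φ, h1, h2, h2.language_not⟩

theorem LangFCREG.compl_mem {L : Language A} (h : L ∈ LangFCREG A) : Lᶜ ∈ LangFCREG A := by
  obtain ⟨φ, h2, rfl⟩ := h
  exact ⟨.not φ, h2, h2.language_not⟩

/-- Over a bounded language, regular constraints can be replaced by `FC`-formulas. -/
theorem IsBounded.exists_replacement {B : Language A} (hB : IsBounded B) :
    ∃ R : Language A, IsBounded R ∧ R.IsRegular ∧
      ∃ f : ℕ → RegularExpression A → Formula A,
        (∀ (x : ℕ) (γ : RegularExpression A), (f x γ).IsFC ∧ (f x γ).freeVars = {x} ∧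
          ∀ (w : List A) (σ : ℕ → Facs w), (f x γ).Sat w σ ↔ (σ x).1 ∈ γ.matches' ⊓ R) ∧
        ∀ φ : Formula A, (φ.replaceConstr f).IsFC ∧
          ∀ w : List A, w ∈ B → ∀ σ : ℕ → Facs w,
            ((φ.replaceConstr f).Sat w σ ↔ φ.Sat w σ) := by
  obtain ⟨ws, hws⟩ := hB
  refine ⟨starProd (ws.flatMap starFactors), isBounded_starProd _, isRegular_starProd _, ?_⟩
  choose f hf using fun x (γ : RegularExpression A) =>
    (Expressible.inf_starProd (isRegular_matches γ) (ws.flatMap starFactors)).exists_formula x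
  refine ⟨f, hf, fun φ => ⟨φ.replaceConstr_isFC fun x γ => (hf x γ).1, fun w hw =>
    φ.sat_replaceConstr fun x γ σ => ((hf x γ).2.2 w σ).trans ?_⟩⟩
  -- Membership in `R` is automatic for factors of words of `B`.
  exact and_iff_left (infix_mem_starProd (hws hw) (σ x).2)

theorem IsBounded.mem_langFC {L : Language A} (hL : IsBounded L) (h : L ∈ LangFCREG A) :
    L ∈ LangFC A := by
  obtain ⟨φ, hφ, rfl⟩ := h
  obtain ⟨ws, hws⟩ := hL
  -- The replacement is made over the whole product, not just over the language of `φ`: the sentence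
  -- `β` can test membership in the product, and outside it the language has no words.
  obtain ⟨_, -, -, f, hf, hrep⟩ := (isBounded_starProd ws).exists_replacement
  obtain ⟨β, b1, b2, b3⟩ := (Expressible.starProd ws).exists_sentence
  have hs : (φ.replaceConstr f).IsSentence :=
    (φ.freeVars_replaceConstr fun x γ => (hf x γ).2.1).trans hφ
  have hs' : (Formula.and β (φ.replaceConstr f)).IsSentence := by
    simp only [Formula.IsSentence, Formula.freeVars] at *
    simp [b2, hs]
  refine ⟨.and β (φ.replaceConstr f), ⟨b1, (hrep φ).1⟩, hs', Language.ext fun w => ?_⟩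
  rw [hs'.mem_language_iff fun _ => Facs.eps w]
  refine (and_congr_left' (b3 w _)).trans ?_
  constructor
  · rintro ⟨hw, h⟩
    exact (hφ.mem_language_iff _).2 (((hrep φ).2 w hw _).1 h)
  · intro hw
    exact ⟨hws hw, ((hrep φ).2 w (hws hw) _).2 (hw _)⟩

end Replace

end FCLogic

/-- A Boolean combination of bounded languages is `FC`-definable iff it is `FC[REG]`-definable.
Moreover, over the words of a fixed bounded language `B`, the regular constraints of any
`FC[REG]`-formula can be intersected with a bounded regular language `R` and then replaced by
equivalent `FC`-formulas. -/
theorem mainTheorem7 {A : Type*} [Finite A] :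
    (∀ L : Language A, FCLogic.IsBoolCombBounded L →
      (L ∈ FCLogic.LangFC A ↔ L ∈ FCLogic.LangFCREG A)) ∧
    (∀ B : Language A, FCLogic.IsBounded B →
      ∃ R : Language A, FCLogic.IsBounded R ∧ R.IsRegular ∧
      ∃ f : ℕ → RegularExpression A → FCLogic.Formula A,
        (∀ (x : ℕ) (γ : RegularExpression A),
          (f x γ).IsFC ∧ (f x γ).freeVars = {x} ∧
          ∀ (w : List A) (σ : ℕ → FCLogic.Facs w),
            (f x γ).Sat w σ ↔ (σ x).1 ∈ γ.matches' ⊓ R) ∧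
        ∀ φ : FCLogic.Formula A, (φ.replaceConstr f).IsFC ∧
          ∀ w : List A, w ∈ B → ∀ σ : ℕ → FCLogic.Facs w,
            ((φ.replaceConstr f).Sat w σ ↔ φ.Sat w σ)) := by
  refine ⟨fun L hL => ⟨?_, fun h => ?_⟩, fun B hB => hB.exists_replacement⟩
  · rintro ⟨φ, -, h, rfl⟩
    exact ⟨φ, h, rfl⟩
  · rcases hL.isBounded_or_compl with hb | hb
    · exact hb.mem_langFC h
    · rw [← compl_compl L]
      exact FCLogic.LangFC.compl_mem (hb.mem_langFC (FCLogic.LangFCREG.compl_mem h))
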